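/- Let $q$ be a prime power, let $n\ge 2$ and $\lceil n/2\rceil\le r\le n-1$ be integers with $\gcd(n,r)=1$, and if $n=2$ assume that $q$ is odd. Put $T_n(z)=z+z^q+\cdots+z^{q^{n-1}}$, let $f_r(x)\in\mathbb F_{q^n}[x]$ be the remainder of $T_n(x^{1+q^r})$ on division by $x^{q^n}-x$, and let $\mathcal X_{n,r}$ be the plane curve $T_n(y)=f_r(x)$ over $\mathbb F_{q^n}$. Let $u(x)=x^{q^{n-r}+1}-x^{q^n+q^{n-r}}$. Then $\mathcal X_{n,r}$ has the plane model $$T_n(y)=x^{q^{n-r}+1}-x^{q^n+q^{n-r}},$$ that is, the polynomials $T_n(y)-f_r(x)$ and $T_n(y)-u(x)$ are irreducible over an algebraic closure of $\mathbb F_{q^n}$, and the function fields over $\mathbb F_{q^n}$ of the two plane curves that they define are isomorphic over $\mathbb F_{q^n}$. More precisely, let $x,y$ be the coordinate functions in the function field $F_{n,r}=\mathbb F_{q^n}(x,y)$ of $\mathcal X_{n,r}$, put $z_0=y^{q^{n-r}}-x^{q^{n-r}+1}$, let $\alpha,\beta$ be any positive integers with $(n-r)\alpha-\beta n=1$, and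 put $$w=-\sum_{i=0}^{\alpha-1}z_0^{\,q^{(n-r)i}}-\sum_{i=1}^{\beta}u(x)^{q^{n(\beta-i)+1}}.$$ Then there is a constant $a\in\mathbb F_{q^n}$ such that $\tilde w=w-a$ satisfies $T_n(\tilde w)=u(x)$, and there is an $\mathbb F_{q^n}$-isomorphism from the function field of the curve $T_n(y)=u(x)$ onto $F_{n,r}$ that sends the coordinate functions $x,y$ to $x,\tilde w$. -/

import Mathlib

open Polynomial

/-- The additive trace polynomial `T_n(z) = z + z^q + ⋯ + z^{q^{n-1}}` evaluated at `z`. -/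
def traceT {A : Type*} [CommRing A] (q n : ℕ) (z : A) : A :=
  ∑ i ∈ Finset.range n, z ^ q ^ i

/-- `f_r(x)`: the remainder of `T_n(x^{1+q^r})` on division by `x^{q^n} - x`. -/
noncomputable def fPoly (K : Type*) [Field K] (q n r : ℕ) : K[X] :=
  traceT q n ((X : K[X]) ^ (1 + q ^ r)) %ₘ ((X : K[X]) ^ q ^ n - X)

/-- `u(x) = x^{q^{n-r}+1} - x^{q^n+q^{n-r}}`, for `x` in any commutative ring. -/
def uFun {A : Type*} [CommRing A] (q n r : ℕ) (x : A) : A :=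
  x ^ (q ^ (n - r) + 1) - x ^ (q ^ n + q ^ (n - r))

/-- The equation `T_n(y) - f_r(x)` of the curve `X_{n,r}`, as an element of `K[x][y]`. -/
noncomputable def curveX (K : Type*) [Field K] (q n r : ℕ) : K[X][X] :=
  traceT q n (X : K[X][X]) - C (fPoly K q n r)

/-- The equation `T_n(y) - (x^{q^{n-r}+1} - x^{q^n+q^{n-r}})`, as an element of `K[x][y]`. -/
noncomputable def newModel (K : Type*) [Field K] (q n r : ℕ) : K[X][X] :=
  traceT q n (X : K[X][X]) - C (uFun q n r (X : K[X]))

/-- The plane affine curve `P(x,y) = 0` is geometrically irreducible: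
`P` is irreducible as a polynomial over an algebraic closure of `K`. -/
def GeomIrreducible {K : Type*} [Field K] (P : K[X][X]) : Prop :=
  Irreducible (P.map (mapRingHom (algebraMap K (AlgebraicClosure K))))

/-- The function field `K(x,y)` of the plane curve `P(x,y) = 0`: the fraction ring of the
coordinate ring `K[x,y]/(P)` (a field whenever `P` is irreducible). -/
abbrev FunField {K : Type*} [Field K] (P : K[X][X]) : Type _ :=
  FractionRing (AdjoinRoot P)

/-- The coordinate function `x` in the function field of `P(x,y) = 0`. -/
noncomputable def xFun {K : Type*} [Field K] (P : K[X][X]) : FunField P :=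
  algebraMap (AdjoinRoot P) (FunField P) (AdjoinRoot.of P X)

/-- The coordinate function `y` in the function field of `P(x,y) = 0`. -/
noncomputable def yFun {K : Type*} [Field K] (P : K[X][X]) : FunField P :=
  algebraMap (AdjoinRoot P) (FunField P) (AdjoinRoot.root P)

/-- `Q(x,y) = 0` is a plane model over `K` of the geometrically irreducible curve `P(x,y) = 0`:
it is geometrically irreducible as well and its function field is `K`-isomorphic to that of the
curve `P(x,y) = 0`, i.e. the two curves are birationally equivalent over `K`. -/
def IsPlaneModel {K : Type*} [Field K] (P Q : K[X][X]) : Prop :=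
  GeomIrreducible P ∧ GeomIrreducible Q ∧ Nonempty (FunField Q ≃ₐ[K] FunField P)

/-- `z₀ = y^{q^{n-r}} - x^{q^{n-r}+1}` in the function field of `X_{n,r}`. -/
noncomputable def zZero (K : Type*) [Field K] (q n r : ℕ) : FunField (curveX K q n r) :=
  yFun (curveX K q n r) ^ q ^ (n - r) - xFun (curveX K q n r) ^ (q ^ (n - r) + 1)

/-- `w = - ∑_{i=0}^{α-1} z₀^{q^{(n-r)i}} - ∑_{i=1}^{β} u(x)^{q^{n(β-i)+1}}`
in the function field of `X_{n,r}`. -/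
noncomputable def wFun (K : Type*) [Field K] (q n r α β : ℕ) : FunField (curveX K q n r) :=
  -(∑ i ∈ Finset.range α, zZero K q n r ^ q ^ ((n - r) * i))
    - ∑ i ∈ Finset.Icc 1 β, uFun q n r (xFun (curveX K q n r)) ^ q ^ (n * (β - i) + 1)

/-!
Write `φ` for the `q`-Frobenius, `s = n - r` and `T_k = 1 + φ + ⋯ + φ ^ (k - 1)`. On `X_{n,r}` one
computes `T_n(z₀) = -T_s(u)`. Since `s α = β n + 1`, the telescoping identity
`T_s ∘ ∑ φ ^ (s i) - T_n ∘ φ ∘ ∑ φ ^ (n j) = 1`, over `i < α` and `j < β`, gives `T_s(w) = -z₀` and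
`T_n(w) = u` (so `a = 0` works), and then `y` is a polynomial in `x` and `w`. Already the coordinate
rings of the two curves are therefore isomorphic over `K[x]`, and it suffices to prove that one of
the two equations is irreducible over an algebraically closed field.

The Galois group of `T_n(Y) = g` embeds in the kernel of `T_n` in the field of order `q ^ n`. If the
equation is reducible, the image is a proper subgroup, and trace duality yields a constant `c ≠ 0`
with `c g = t ^ p - t` for a polynomial `t`. For `g = u` and `n ≠ 2 r` this is refuted by the
coefficients at `(q ^ s + 1) p ^ j`; otherwise `n = 2`, `r = 1`, and `f_1 = 2 x ^ (q + 1)` is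
refuted in the same way.
-/

section AdditivePow

/-- Raising to the power `q` is additive on `A`, as it is when `q` is a power of the prime
characteristic of `A`. The trace identities below use only this property of `q`, which passes from
`q` to its powers; unlike `CharP`, it also passes to every `A`-algebra. -/
class IsAdditivePow (A : Type*) [CommRing A] (q : ℕ) : Prop where
  add_pow (x y : A) : (x + y) ^ q = x ^ q + y ^ q

variable (A : Type*) [CommRing A]

/-- The `q`-th power map as a ring endomorphism. -/
def powHom (q : ℕ) [IsAdditivePow A q] : A →+* A where
  __ := powMonoidHom q
  __ := AddMonoidHom.mk' (fun x : A => x ^ q) IsAdditivePow.add_pow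

variable {A}

theorem IsAdditivePow.sub_pow {q : ℕ} [IsAdditivePow A q] (x y : A) :
    (x - y) ^ q = x ^ q - y ^ q :=
  map_sub (powHom A q) x y

theorem IsAdditivePow.neg_pow {q : ℕ} [IsAdditivePow A q] (x : A) : (-x) ^ q = -x ^ q :=
  map_neg (powHom A q) x

theorem IsAdditivePow.zero_pow {q : ℕ} [IsAdditivePow A q] : (0 : A) ^ q = 0 :=
  map_zero (powHom A q)

instance (q k : ℕ) [IsAdditivePow A q] : IsAdditivePow A (q ^ k) where
  add_pow x y := by
    induction k with
    | zero => simp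
    | succ k ih => rw [pow_succ, pow_mul, ih, IsAdditivePow.add_pow, ← pow_mul, ← pow_mul]

theorem IsAdditivePow.of_algebra (R : Type*) [CommRing R] [Algebra R A] (p : ℕ) [Fact p.Prime]
    [CharP R p] : IsAdditivePow A p where
  add_pow x y := by
    obtain ⟨z, hz⟩ := exists_add_pow_prime_eq (Fact.out : p.Prime) x y
    have hp : (p : A) = 0 := by rw [← map_natCast (algebraMap R A), CharP.cast_eq_zero, map_zero]
    rw [hz, hp]
    ring

instance (p : ℕ) [Fact p.Prime] [CharP A p] : IsAdditivePow A p := .of_algebra A p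

end AdditivePow

section Trace

variable {A B : Type*} [CommRing A] [CommRing B]

theorem map_traceT (φ : A →+* B) (q n : ℕ) (z : A) : φ (traceT q n z) = traceT q n (φ z) := by
  simp [traceT]

theorem traceT_one (q : ℕ) (z : A) : traceT q 1 z = z := by simp [traceT]

theorem traceT_succ (q n : ℕ) (z : A) : traceT q (n + 1) z = traceT q n z + z ^ q ^ n :=
  Finset.sum_range_succ _ _

theorem traceT_add_length (q a b : ℕ) (z : A) :
    traceT q (a + b) z = traceT q a z + traceT q b (z ^ q ^ a) := by
  simp only [traceT, Finset.sum_range_add, ← pow_mul, ← pow_add]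

theorem sub_dvd_traceT_sub_traceT (q n : ℕ) (x y : A) :
    x - y ∣ traceT q n x - traceT q n y := by
  rw [traceT, traceT, ← Finset.sum_sub_distrib]
  exact Finset.dvd_sum fun i _ => sub_dvd_pow_sub_pow x y _

theorem traceT_mul_of_pow_eq {q : ℕ} {c : A} (hc : c ^ q = c) (n : ℕ) (z : A) :
    traceT q n (c * z) = c * traceT q n z := by
  have hci (i : ℕ) : c ^ q ^ i = c := by
    induction i with
    | zero => simp
    | succ i ih => rw [pow_succ, pow_mul, ih, hc]
  simp only [traceT, mul_pow, hci, Finset.mul_sum]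

/-- The trace polynomial as an additive endomorphism. -/
def traceHom (A : Type*) [CommRing A] (q n : ℕ) [IsAdditivePow A q] : A →+ A :=
  AddMonoidHom.mk' (traceT q n) fun x y => by
    simp only [traceT, IsAdditivePow.add_pow, Finset.sum_add_distrib]

theorem traceHom_apply (q n : ℕ) [IsAdditivePow A q] (z : A) : traceHom A q n z = traceT q n z :=
  rfl

theorem traceT_zero (q n : ℕ) [IsAdditivePow A q] : traceT q n (0 : A) = 0 :=
  map_zero (traceHom A q n)

theorem traceT_neg (q n : ℕ) [IsAdditivePow A q] (z : A) : traceT q n (-z) = -traceT q n z :=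
  map_neg (traceHom A q n) z

theorem traceT_add (q n : ℕ) [IsAdditivePow A q] (x y : A) :
    traceT q n (x + y) = traceT q n x + traceT q n y :=
  map_add (traceHom A q n) x y

theorem traceT_sub (q n : ℕ) [IsAdditivePow A q] (x y : A) :
    traceT q n (x - y) = traceT q n x - traceT q n y :=
  map_sub (traceHom A q n) x y

theorem traceT_pow (q n k : ℕ) [IsAdditivePow A k] (z : A) :
    traceT q n (z ^ k) = traceT q n z ^ k :=
  (map_traceT (powHom A k) q n z).symm

theorem traceT_comm (q q' a b : ℕ) [IsAdditivePow A q] [IsAdditivePow A q'] (z : A) :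
    traceT q a (traceT q' b z) = traceT q' b (traceT q a z) := by
  rw [← traceHom_apply, traceT, map_sum]
  exact Finset.sum_congr rfl fun i _ => traceT_pow q a _ z

theorem traceT_mul_length (q a b : ℕ) [IsAdditivePow A q] (z : A) :
    traceT q (a * b) z = traceT (q ^ a) b (traceT q a z) := by
  induction b with
  | zero => simp [traceT]
  | succ b ih => rw [mul_add_one, traceT_add_length, ih, traceT_pow, traceT_succ, pow_mul]

theorem sub_pow_eq_traceT_sub_pow (q n : ℕ) [IsAdditivePow A q] (z : A) :
    z - z ^ q ^ n = traceT q n z - traceT q n z ^ q := by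
  have h : traceT q n z + z ^ q ^ n = z + traceT q n z ^ q := by
    rw [← traceT_succ, add_comm n, traceT_add_length, traceT_one, pow_one, traceT_pow]
  linear_combination -h

theorem traceT_bezout {q s n α β : ℕ} [IsAdditivePow A q] (h : s * α = β * n + 1) (v : A) :
    traceT (q ^ s) α (traceT q s v) - traceT (q ^ n) β (traceT q n v ^ q) = v := by
  rw [← traceT_mul_length, ← traceT_pow, ← traceT_mul_length, h, add_comm, mul_comm β,
    traceT_add_length, traceT_one, pow_one, add_sub_cancel_right]

theorem traceT_mul_pow_sub_self {p m n : ℕ} [IsAdditivePow A p] {c : A}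
    (hc : c ^ (p ^ m) ^ n = c) (y : A) :
    traceT p (m * n) (c * y) ^ p - traceT p (m * n) (c * y) =
      c * (traceT (p ^ m) n y ^ p ^ m - traceT (p ^ m) n y) := by
  have h₁ := sub_pow_eq_traceT_sub_pow p (m * n) (c * y)
  have h₂ := sub_pow_eq_traceT_sub_pow (p ^ m) n y
  rw [pow_mul p, mul_pow, hc] at h₁
  linear_combination h₁ - c * h₂

end Trace

section Coordinates

variable {A B : Type*} [CommRing A] [CommRing B]

/-- The reduction of `T_n(x ^ (1 + q ^ r))` modulo `x ^ q ^ n - x`, in closed form and for `x` in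
any commutative ring. -/
def fFun (q n r : ℕ) (x : A) : A :=
  traceT q (n - r) (x ^ (1 + q ^ r)) + traceT q r (x ^ (q ^ (n - r) + 1))

/-- `z₀` as a function of the coordinates `x`, `y` of the curve `T_n(y) = f_r(x)`. -/
def zCoord (q n r : ℕ) (x y : A) : A := y ^ q ^ (n - r) - x ^ (q ^ (n - r) + 1)

/-- `w` as a function of the coordinates `x`, `y` of the curve `T_n(y) = f_r(x)`; its two sums are
traces with respect to the bases `q ^ (n - r)` and `q ^ n`. -/
def wCoord (q n r α β : ℕ) (x y : A) : A :=
  -traceT (q ^ (n - r)) α (zCoord q n r x y) - traceT (q ^ n) β (uFun q n r x ^ q)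

/-- `y` as a function of the coordinates `x`, `w` of the curve `T_n(w) = u(x)`. As
`T_{n-r}(w) = -z₀`, the last power is `y ^ q ^ n`, and `y - y ^ q ^ n = f_r(x) - f_r(x) ^ q`. -/
def yCoord (q n r : ℕ) (x w : A) : A :=
  fFun q n r x - fFun q n r x ^ q + (x ^ (q ^ (n - r) + 1) - traceT q (n - r) w) ^ q ^ r

theorem map_uFun (φ : A →+* B) (q n r : ℕ) (x : A) : φ (uFun q n r x) = uFun q n r (φ x) := by
  simp [uFun]

theorem map_fFun (φ : A →+* B) (q n r : ℕ) (x : A) : φ (fFun q n r x) = fFun q n r (φ x) := by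
  simp [fFun, map_traceT]

theorem map_wCoord (φ : A →+* B) (q n r α β : ℕ) (x y : A) :
    φ (wCoord q n r α β x y) = wCoord q n r α β (φ x) (φ y) := by
  simp [wCoord, zCoord, map_traceT, map_uFun]

theorem map_yCoord (φ : A →+* B) (q n r : ℕ) (x w : A) :
    φ (yCoord q n r x w) = yCoord q n r (φ x) (φ w) := by
  simp [yCoord, map_fFun, map_traceT]

variable {q n r α β : ℕ} [IsAdditivePow A q] {x y w : A}

theorem fFun_pow (hrn : r ≤ n) (x : A) :
    fFun q n r x ^ q ^ (n - r) =
      traceT q n (x ^ (q ^ (n - r) + 1)) - traceT q (n - r) (uFun q n r x) := by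
  obtain ⟨s, rfl⟩ := Nat.exists_eq_add_of_le' hrn
  have hx : (x ^ (1 + q ^ r)) ^ q ^ s = x ^ (q ^ (s + r) + q ^ s) := by
    rw [← pow_mul]
    ring_nf
  rw [fFun, uFun, Nat.add_sub_cancel, IsAdditivePow.add_pow, ← traceT_pow, ← traceT_pow, hx,
    traceT_add_length, traceT_sub]
  ring

theorem traceT_zCoord (hrn : r ≤ n) (hy : traceT q n y = fFun q n r x) :
    traceT q n (zCoord q n r x y) = -traceT q (n - r) (uFun q n r x) := by
  rw [zCoord, traceT_sub, traceT_pow, hy, fFun_pow hrn]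
  ring

theorem traceT_wCoord_eq_neg_zCoord (hαβ : (n - r) * α = β * n + 1) (hrn : r ≤ n)
    (hy : traceT q n y = fFun q n r x) :
    traceT q (n - r) (wCoord q n r α β x y) = -zCoord q n r x y := by
  have hu : traceT q (n - r) (uFun q n r x) = -traceT q n (zCoord q n r x y) := by
    rw [traceT_zCoord hrn hy, neg_neg]
  rw [wCoord, traceT_sub, traceT_neg, traceT_comm, traceT_comm q, traceT_pow, hu,
    IsAdditivePow.neg_pow, traceT_neg]
  linear_combination -traceT_bezout (q := q) hαβ (zCoord q n r x y)

theorem traceT_wCoord_eq_uFun (hαβ : (n - r) * α = β * n + 1) (hrn : r ≤ n)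
    (hy : traceT q n y = fFun q n r x) :
    traceT q n (wCoord q n r α β x y) = uFun q n r x := by
  rw [wCoord, traceT_sub, traceT_neg, traceT_comm, traceT_comm q, traceT_pow,
    traceT_zCoord hrn hy, traceT_neg, neg_neg]
  exact traceT_bezout hαβ _

theorem yCoord_wCoord (hαβ : (n - r) * α = β * n + 1) (hrn : r ≤ n)
    (hy : traceT q n y = fFun q n r x) :
    yCoord q n r x (wCoord q n r α β x y) = y := by
  rw [yCoord, traceT_wCoord_eq_neg_zCoord hαβ hrn hy, zCoord, sub_neg_eq_add, add_sub_cancel,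
    ← pow_mul, ← pow_add, Nat.sub_add_cancel hrn, ← hy, ← sub_pow_eq_traceT_sub_pow,
    sub_add_cancel]

theorem traceT_sub_traceT (hrn : r ≤ n) (hw : traceT q n w = uFun q n r x) :
    traceT q n (x ^ (q ^ (n - r) + 1) - traceT q (n - r) w) = fFun q n r x ^ q ^ (n - r) := by
  rw [fFun_pow hrn, traceT_sub, traceT_comm, hw]

theorem yCoord_pow (hrn : r ≤ n) (hw : traceT q n w = uFun q n r x) :
    yCoord q n r x w ^ q ^ (n - r) = x ^ (q ^ (n - r) + 1) - traceT q (n - r) w := by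
  have h := sub_pow_eq_traceT_sub_pow q n (x ^ (q ^ (n - r) + 1) - traceT q (n - r) w)
  rw [traceT_sub_traceT hrn hw] at h
  rw [yCoord, IsAdditivePow.add_pow, IsAdditivePow.sub_pow, ← pow_mul _ (q ^ r), ← pow_add,
    Nat.add_sub_cancel' hrn, pow_right_comm]
  linear_combination -h

theorem traceT_yCoord (hrn : r ≤ n) (hw : traceT q n w = uFun q n r x) :
    traceT q n (yCoord q n r x w) = fFun q n r x := by
  rw [yCoord, traceT_add, traceT_sub, traceT_pow, traceT_pow, traceT_sub_traceT hrn hw, ← pow_mul,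
    ← pow_add, Nat.sub_add_cancel hrn, ← sub_pow_eq_traceT_sub_pow, sub_add_cancel]

theorem wCoord_yCoord (hαβ : (n - r) * α = β * n + 1) (hrn : r ≤ n)
    (hw : traceT q n w = uFun q n r x) :
    wCoord q n r α β x (yCoord q n r x w) = w := by
  have hz : zCoord q n r x (yCoord q n r x w) = -traceT q (n - r) w := by
    rw [zCoord, yCoord_pow hrn hw]
    ring
  rw [wCoord, hz, traceT_neg, neg_neg, ← hw]
  exact traceT_bezout hαβ w

end Coordinates

section TracePolynomial

variable {R S : Type*} [CommRing R] [CommRing S]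

/-- The polynomial `T_n(Y) - g` over a ring containing `g`; the equations of both plane curves are
of this form over `K[x]`. -/
noncomputable def traceSubC (q n : ℕ) (g : R) : R[X] := traceT q n X - C g

theorem eval₂_traceSubC (i : R →+* S) (q n : ℕ) (g : R) (z : S) :
    eval₂ i z (traceSubC q n g) = traceT q n z - i g := by
  simp [traceSubC, traceT, eval₂_finsetSum]

theorem map_traceSubC (i : R →+* S) (q n : ℕ) (g : R) :
    (traceSubC q n g).map i = traceSubC q n (i g) := by
  simp [traceSubC, traceT, Polynomial.map_sum]

theorem traceT_root (q n : ℕ) (g : R) :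
    traceT q n (AdjoinRoot.root (traceSubC q n g)) = AdjoinRoot.of (traceSubC q n g) g := by
  rw [← sub_eq_zero, ← eval₂_traceSubC, AdjoinRoot.eval₂_root]

theorem traceSubC_succ (q n : ℕ) (g : R) :
    traceSubC q (n + 1) g = X ^ q ^ n + traceSubC q n g := by
  rw [traceSubC, traceSubC, traceT_succ]
  ring

theorem degree_traceSubC_lt {q : ℕ} (hq : 1 < q) (n : ℕ) (g : R) :
    (traceSubC q n g).degree < (q ^ n : ℕ) := by
  induction n with
  | zero =>
    rw [traceSubC, traceT, Finset.range_zero, Finset.sum_empty, zero_sub, degree_neg]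
    exact degree_C_le.trans_lt (by simp)
  | succ n ih =>
    have hlt : ((q ^ n : ℕ) : WithBot ℕ) < (q ^ (n + 1) : ℕ) :=
      Nat.cast_lt.2 (Nat.pow_lt_pow_right hq n.lt_succ_self)
    rw [traceSubC_succ]
    exact (degree_add_le _ _).trans_lt
      (max_lt ((degree_X_pow_le _).trans_lt hlt) (ih.trans hlt))

theorem monic_traceSubC {q n : ℕ} (hq : 1 < q) (hn : n ≠ 0) (g : R) :
    (traceSubC q n g).Monic := by
  obtain ⟨k, rfl⟩ := Nat.exists_eq_succ_of_ne_zero hn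
  rw [traceSubC_succ]
  exact monic_X_pow_add (degree_traceSubC_lt hq k g)

theorem degree_traceSubC_pos [Nontrivial R] {q n : ℕ} (hq : 1 < q) (hn : n ≠ 0) (g : R) :
    0 < (traceSubC q n g).degree := by
  obtain ⟨k, rfl⟩ := Nat.exists_eq_succ_of_ne_zero hn
  have hlt : (traceSubC q k g).degree < (X ^ q ^ k : R[X]).degree :=
    (degree_traceSubC_lt hq k g).trans_eq (degree_X_pow _).symm
  rw [traceSubC_succ, degree_add_eq_left_of_degree_lt hlt, degree_X_pow]
  exact_mod_cast pow_pos (zero_lt_one.trans hq) k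

theorem separable_traceSubC {p m n : ℕ} [CharP R p] (hm : m ≠ 0) (hn : n ≠ 0) (g : R) :
    (traceSubC (p ^ m) n g).Separable := by
  have hder : derivative (traceSubC (p ^ m) n g) = 1 := by
    obtain ⟨k, rfl⟩ := Nat.exists_eq_succ_of_ne_zero hn
    rw [traceSubC, traceT, Finset.sum_range_succ']
    simp [derivative_X_pow, pow_succ, hm]
  rw [separable_def, hder]
  exact isCoprime_one_right

/-- The homomorphism out of `R[Y] / (T_n(Y) - g)` that sends `Y` to `z`. -/
noncomputable def traceLift [Algebra R S] {q n : ℕ} {g : R} (z : S)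
    (hz : traceT q n z = algebraMap R S g) : AdjoinRoot (traceSubC q n g) →ₐ[R] S :=
  AdjoinRoot.liftAlgHom _ (Algebra.ofId R S) z
    ((eval₂_traceSubC _ _ _ _ _).trans (sub_eq_zero.2 hz))

theorem traceLift_root [Algebra R S] {q n : ℕ} {g : R} (z : S)
    (hz : traceT q n z = algebraMap R S g) :
    traceLift z hz (AdjoinRoot.root (traceSubC q n g)) = z :=
  AdjoinRoot.liftAlgHom_root _ _ _ _

end TracePolynomial

section CoordinateRing

variable {R : Type*} [CommRing R] {p m n r α β : ℕ} [Fact p.Prime] [CharP R p]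

instance (P : R[X]) : IsAdditivePow (AdjoinRoot P) p := .of_algebra R p

theorem traceT_root_uFun (q n r : ℕ) (x : R) :
    traceT q n (AdjoinRoot.root (traceSubC q n (uFun q n r x))) =
      uFun q n r (algebraMap R _ x) := by
  rw [traceT_root, AdjoinRoot.algebraMap_eq, map_uFun]

theorem traceT_root_fFun (q n r : ℕ) (x : R) :
    traceT q n (AdjoinRoot.root (traceSubC q n (fFun q n r x))) =
      fFun q n r (algebraMap R _ x) := by
  rw [traceT_root, AdjoinRoot.algebraMap_eq, map_fFun]

/-- The mutually inverse polynomial maps `wCoord` and `yCoord` as an isomorphism between the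
coordinate rings of the two curves; `x` may be any element of the base ring. -/
noncomputable def coordinateRingEquiv (hrn : r ≤ n) (hαβ : (n - r) * α = β * n + 1) (x : R) :
    AdjoinRoot (traceSubC (p ^ m) n (uFun (p ^ m) n r x)) ≃ₐ[R]
      AdjoinRoot (traceSubC (p ^ m) n (fFun (p ^ m) n r x)) :=
  AlgEquiv.ofAlgHom
    (traceLift (wCoord (p ^ m) n r α β (algebraMap R _ x) (AdjoinRoot.root _))
      (by rw [traceT_wCoord_eq_uFun hαβ hrn (traceT_root_fFun _ _ _ _), map_uFun]))
    (traceLift (yCoord (p ^ m) n r (algebraMap R _ x) (AdjoinRoot.root _))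
      (by rw [traceT_yCoord hrn (traceT_root_uFun _ _ _ _), map_fFun]))
    (AdjoinRoot.algHom_ext (by
      rw [AlgHom.comp_apply, traceLift_root, ← AlgHom.coe_toRingHom, map_yCoord,
        AlgHom.coe_toRingHom, AlgHom.commutes, traceLift_root, AlgHom.id_apply,
        yCoord_wCoord hαβ hrn (traceT_root_fFun _ _ _ _)]))
    (AdjoinRoot.algHom_ext (by
      rw [AlgHom.comp_apply, traceLift_root, ← AlgHom.coe_toRingHom, map_wCoord,
        AlgHom.coe_toRingHom, AlgHom.commutes, traceLift_root, AlgHom.id_apply,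
        wCoord_yCoord hαβ hrn (traceT_root_uFun _ _ _ _)]))

theorem coordinateRingEquiv_root (hrn : r ≤ n) (hαβ : (n - r) * α = β * n + 1) (x : R) :
    coordinateRingEquiv (p := p) (m := m) hrn hαβ x (AdjoinRoot.root _) =
      wCoord (p ^ m) n r α β (algebraMap R _ x) (AdjoinRoot.root _) := by
  rw [coordinateRingEquiv, AlgEquiv.ofAlgHom_apply, traceLift_root]

end CoordinateRing

section Reduction

theorem natDegree_traceT_X_pow_le {R : Type*} [CommRing R] {q : ℕ} (hq : q ≠ 0) (n d : ℕ) :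
    (traceT q n ((X : R[X]) ^ d)).natDegree ≤ d * q ^ (n - 1) := by
  refine natDegree_sum_le_of_forall_le _ _ fun i hi => ?_
  rw [← pow_mul]
  have hin : i ≤ n - 1 := Nat.le_sub_one_of_lt (Finset.mem_range.1 hi)
  exact (natDegree_X_pow_le _).trans
    (Nat.mul_le_mul_left d (Nat.pow_le_pow_right (Nat.pos_of_ne_zero hq) hin))

theorem pow_add_one_mul_pow_lt {q : ℕ} (hq : 1 < q) (a : ℕ) {b : ℕ} (hb : b ≠ 0) :
    (q ^ b + 1) * q ^ a < q ^ (a + b + 1) := by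
  have hqb : q ^ b + 1 < q ^ b * q := by
    have := Nat.one_lt_pow hb hq
    nlinarith
  calc (q ^ b + 1) * q ^ a < q ^ b * q * q ^ a :=
        Nat.mul_lt_mul_of_pos_right hqb (pow_pos (zero_lt_one.trans hq) a)
    _ = q ^ (a + b + 1) := by ring

theorem natDegree_fFun_lt {R : Type*} [CommRing R] {q n r : ℕ} (hq : 1 < q) (hr : r ≠ 0)
    (hrn : r < n) : (fFun q n r (X : R[X])).natDegree < q ^ n := by
  have hs : n - r ≠ 0 := Nat.sub_ne_zero_of_lt hrn
  have hq0 : q ≠ 0 := (zero_lt_one.trans hq).ne'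
  have h₁ : (1 + q ^ r) * q ^ (n - r - 1) < q ^ n := by
    have h := pow_add_one_mul_pow_lt hq (n - r - 1) hr
    rwa [add_comm _ 1, show n - r - 1 + r + 1 = n by omega] at h
  have h₂ : (q ^ (n - r) + 1) * q ^ (r - 1) < q ^ n := by
    have h := pow_add_one_mul_pow_lt hq (r - 1) hs
    rwa [show r - 1 + (n - r) + 1 = n by omega] at h
  exact (natDegree_add_le _ _).trans_lt
    (max_lt ((natDegree_traceT_X_pow_le hq0 _ _).trans_lt h₁)
      ((natDegree_traceT_X_pow_le hq0 _ _).trans_lt h₂))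

theorem X_pow_sub_X_dvd_traceT_sub_fFun {R : Type*} [CommRing R] (q : ℕ) {n r : ℕ}
    (hrn : r ≤ n) :
    (X : R[X]) ^ q ^ n - X ∣ traceT q n (X ^ (1 + q ^ r)) - fFun q n r X := by
  obtain ⟨s, rfl⟩ := Nat.exists_eq_add_of_le' hrn
  have hx : ((X : R[X]) ^ (1 + q ^ r)) ^ q ^ s - X ^ (q ^ s + 1) =
      X ^ q ^ s * (X ^ q ^ (s + r) - X) := by
    ring
  rw [fFun, Nat.add_sub_cancel, traceT_add_length, add_sub_add_left_eq_sub]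
  exact (Dvd.intro_left _ hx.symm).trans (sub_dvd_traceT_sub_traceT q r _ _)

theorem fPoly_eq_fFun {K : Type*} [Field K] {q n r : ℕ} (hq : 1 < q) (hr : r ≠ 0) (hrn : r < n) :
    fPoly K q n r = fFun q n r X := by
  have hqn : 1 < q ^ n := Nat.one_lt_pow (Nat.ne_zero_of_lt hrn) hq
  have hmonic : ((X : K[X]) ^ q ^ n - X).Monic :=
    monic_X_pow_sub (degree_X_le.trans_lt (by exact_mod_cast hqn))
  have hdeg : (fFun q n r (X : K[X])).degree < ((X : K[X]) ^ q ^ n - X).degree := by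
    refine degree_lt_degree ?_
    rw [FiniteField.X_pow_card_sub_X_natDegree_eq _ hqn]
    exact natDegree_fFun_lt hq hr hrn
  rw [fPoly, modByMonic_eq_of_dvd_sub hmonic (X_pow_sub_X_dvd_traceT_sub_fFun q hrn.le),
    (modByMonic_eq_self_iff hmonic).2 hdeg]

end Reduction

section ArtinSchreier

theorem coeff_pow_char {R : Type*} [CommRing R] {p : ℕ} [Fact p.Prime] [CharP R p] (t : R[X])
    (N : ℕ) : (t ^ p).coeff N = if p ∣ N then t.coeff (N / p) ^ p else 0 := by
  rw [← map_frobenius_expand p t, coeff_map, coeff_expand (Fact.out : p.Prime).pos]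
  split_ifs <;> simp [frobenius_def, (Fact.out : p.Prime).ne_zero]

-- The coefficients of `t` at `N * p ^ j` would all be nonzero.
theorem pow_char_sub_self_ne {R : Type*} [CommRing R] [IsReduced R] {p N : ℕ} [Fact p.Prime]
    [CharP R p] (hN : ¬p ∣ N) {g : R[X]} (h0 : g.coeff N ≠ 0)
    (h : ∀ j, g.coeff (N * p ^ (j + 1)) = 0) (t : R[X]) : t ^ p - t ≠ g := by
  rintro rfl
  have hp : p.Prime := Fact.out
  have hcoeff (j : ℕ) : t.coeff (N * p ^ j) ≠ 0 := by
    induction j with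
    | zero => simpa [coeff_pow_char, hN] using h0
    | succ j ih =>
      have hdvd : p ∣ N * p ^ (j + 1) := (dvd_pow_self p j.succ_ne_zero).mul_left N
      have hdiv : N * p ^ (j + 1) / p = N * p ^ j := by
        rw [pow_succ, ← mul_assoc, Nat.mul_div_cancel _ hp.pos]
      have hj := h j
      rw [coeff_sub, coeff_pow_char, if_pos hdvd, hdiv, sub_eq_zero] at hj
      exact hj ▸ pow_ne_zero p ih
  refine hcoeff t.natDegree.succ (coeff_eq_zero_of_natDegree_lt ?_)
  have hNpos : 0 < N := Nat.pos_of_ne_zero fun h => hN (h ▸ dvd_zero p)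
  calc t.natDegree < t.natDegree.succ := Nat.lt_succ_self _
    _ < p ^ t.natDegree.succ := Nat.lt_pow_self hp.one_lt
    _ ≤ N * p ^ t.natDegree.succ := Nat.le_mul_of_pos_left _ hNpos

theorem exists_pow_sub_self_eq_of_isIntegrallyClosed {R : Type*} [CommRing R] [IsDomain R]
    [IsIntegrallyClosed R] {p : ℕ} (hp : 1 < p) {a : R} {t : FractionRing R}
    (ht : t ^ p - t = algebraMap R (FractionRing R) a) : ∃ s : R, s ^ p - s = a := by
  have hmonic : (X ^ p - (X + C a)).Monic :=
    (monic_X_pow p).sub_of_left <| by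
      rw [degree_X_pow]
      exact (degree_X_add_C a).trans_lt (by exact_mod_cast hp)
  have hintegral : IsIntegral R t :=
    ⟨X ^ p - (X + C a), hmonic, by simp [← ht]⟩
  obtain ⟨s, rfl⟩ := IsIntegrallyClosed.isIntegral_iff.1 hintegral
  refine ⟨s, IsFractionRing.injective R (FractionRing R) ?_⟩
  rw [map_sub, map_pow, ht]

end ArtinSchreier

section FiniteField

variable {K : Type*} [Field K] [Finite K]

theorem pow_natCard_eq_self (a : K) : a ^ Nat.card K = a := by
  have := Fintype.ofFinite K
  rw [Nat.card_eq_fintype_card, FiniteField.pow_card]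

theorem exists_algebraMap_eq_of_pow_natCard_eq {E : Type*} [Field E] [Algebra K E] {d : E}
    (hd : d ^ Nat.card K = d) : ∃ a : K, algebraMap K E a = d := by
  have hne : (X ^ Nat.card K - X : K[X]) ≠ 0 :=
    FiniteField.X_pow_card_sub_X_ne_zero K Finite.one_lt_card
  have hroot : d ∈ ((X ^ Nat.card K - X : K[X]).map (algebraMap K E)).roots := by
    rw [mem_roots (map_ne_zero hne)]
    simp [hd]
  rw [splits_X_pow_nat_card_sub_X.roots_map] at hroot
  obtain ⟨a, -, ha⟩ := Multiset.mem_map.1 hroot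
  exact ⟨a, ha⟩

variable {p : ℕ} [Fact p.Prime]

theorem algebraMap_trace_eq_traceT [Algebra (ZMod p) K] {k : ℕ} (hK : Nat.card K = p ^ k)
    (z : K) : algebraMap (ZMod p) K (Algebra.trace (ZMod p) K z) = traceT p k z := by
  have hrank : Module.finrank (ZMod p) K = k := by
    have h := Module.natCard_eq_pow_finrank (K := ZMod p) (V := K)
    rw [hK, Nat.card_zmod] at h
    exact (Nat.pow_right_injective (Fact.out : p.Prime).two_le h).symm
  rw [FiniteField.algebraMap_trace_eq_sum_pow, hrank, Nat.card_zmod, traceT]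

theorem exists_traceT_mul_ne_zero_of_notMem [CharP K p] {k : ℕ} (hK : Nat.card K = p ^ k)
    (G : AddSubgroup K) {v : K} (hv : v ∉ G) :
    ∃ c : K, (∀ a ∈ G, traceT p k (c * a) = 0) ∧ traceT p k (c * v) ≠ 0 := by
  let : Algebra (ZMod p) K := ZMod.algebra K p
  obtain ⟨f, hfv, hfG⟩ := Submodule.exists_le_ker_of_notMem
    (p := AddSubgroup.toZModSubmodule p G) (v := v) hv
  let c := (LinearMap.BilinForm.toDual _ (traceForm_nondegenerate (ZMod p) K)).symm f
  have hc (z : K) : traceT p k (c * z) = algebraMap (ZMod p) K (f z) := by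
    rw [← algebraMap_trace_eq_traceT hK, ← Algebra.traceForm_apply,
      LinearMap.BilinForm.apply_toDual_symm_apply]
  refine ⟨c, fun a ha => ?_, ?_⟩
  · rw [hc, LinearMap.mem_ker.1 (hfG ha), map_zero]
  · rwa [hc, Ne, FaithfulSMul.algebraMap_eq_zero_iff]

theorem exists_traceT_mul_eq_zero_of_notMem [CharP K p] {m n : ℕ}
    (hK : Nat.card K = (p ^ m) ^ n) (G : AddSubgroup K) {v : K} (hv : v ∉ G)
    (hT : traceT (p ^ m) n v = 0) :
    ∃ c : K, c ^ p ^ m ≠ c ∧ ∀ a ∈ G, traceT p (m * n) (c * a) = 0 := by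
  rw [← pow_mul] at hK
  obtain ⟨c, hcG, hcv⟩ := exists_traceT_mul_ne_zero_of_notMem hK G hv
  refine ⟨c, fun hc => hcv ?_, hcG⟩
  rw [traceT_mul_length, ← traceT_comm, traceT_mul_of_pow_eq hc, hT, mul_zero, traceT_zero]

theorem exists_eq_add_algebraMap_of_traceT_eq {E : Type*} [Field E] [Algebra K E] {q n : ℕ}
    [IsAdditivePow E q] (hK : Nat.card K = q ^ n) {y z : E}
    (h : traceT q n z = traceT q n y) :
    ∃ a : K, traceT q n a = 0 ∧ z = y + algebraMap K E a := by
  have hd : traceT q n (z - y) = 0 := by rw [traceT_sub, h, sub_self]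
  have hfix := sub_pow_eq_traceT_sub_pow q n (z - y)
  rw [hd, IsAdditivePow.zero_pow, sub_zero, sub_eq_zero, ← hK] at hfix
  obtain ⟨a, ha⟩ := exists_algebraMap_eq_of_pow_natCard_eq hfix.symm
  refine ⟨a, (algebraMap K E).injective ?_, by rw [ha, add_sub_cancel]⟩
  rw [map_traceT, ha, hd, map_zero]

theorem exists_pow_sub_self_eq_mul_of_pow_sub_self {R : Type*} [CommRing R] [Algebra K R]
    {p m n : ℕ} [IsAdditivePow R p] (hn : n ≠ 0)
    (hK : Nat.card K = (p ^ m) ^ n) {g t : R} {c : K} (hc : c ^ p ^ m ≠ c)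
    (ht : t ^ p - t = algebraMap K R c * (g ^ p ^ m - g)) :
    ∃ d : K, d ≠ 0 ∧ ∃ s : R, s ^ p - s = algebraMap K R d * g := by
  set d := c ^ (p ^ m) ^ (n - 1) with hd
  have hdc : d ^ p ^ m = c := by
    rw [hd, ← pow_mul, ← pow_succ, Nat.sub_add_cancel (Nat.pos_of_ne_zero hn), ← hK,
      pow_natCard_eq_self]
  refine ⟨d - c, fun h => hc ?_, t - traceT p m (algebraMap K R d * g), ?_⟩
  · rw [sub_eq_zero] at h
    rw [← h, hdc, h]
  · have h := sub_pow_eq_traceT_sub_pow p m (algebraMap K R d * g)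
    rw [mul_pow, ← map_pow, hdc] at h
    rw [IsAdditivePow.sub_pow, map_sub]
    linear_combination ht - h

end FiniteField

section Irreducibility

theorem irreducible_iff_isDomain_adjoinRoot {R : Type*} [CommRing R] [IsDomain R]
    [UniqueFactorizationMonoid R] {P : R[X]} (hP : P ≠ 0) :
    Irreducible P ↔ IsDomain (AdjoinRoot P) := by
  rw [irreducible_iff_prime, ← Ideal.span_singleton_prime hP]
  exact (Ideal.Quotient.isDomain_iff_prime _).symm

theorem irreducible_of_forall_root_isConjRoot {F E : Type*} [Field F] [Field E] [Algebra F E]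
    {P : F[X]} (hsep : P.Separable) (hsplit : (P.map (algebraMap F E)).Splits) {y : E}
    (hy : aeval y P = 0) (hconj : ∀ z : E, aeval z P = 0 → IsConjRoot F y z) :
    Irreducible P := by
  have hintegral : IsIntegral F y := IsAlgebraic.isIntegral ⟨P, hsep.ne_zero, hy⟩
  have hdvd : P ∣ minpoly F y := by
    rw [← map_dvd_map' (algebraMap F E)]
    refine hsplit.dvd_of_roots_le_roots (map_ne_zero hsep.ne_zero) ?_
    rw [Multiset.le_iff_subset (nodup_roots hsep.map)]
    intro z hz
    rw [mem_roots (map_ne_zero hsep.ne_zero), IsRoot, eval_map_algebraMap] at hz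
    rw [mem_roots (map_ne_zero (minpoly.ne_zero hintegral)), IsRoot, eval_map_algebraMap]
    exact (hconj z hz).aeval_eq_zero
  have hassoc : Associated (minpoly F y) P := associated_of_dvd_dvd (minpoly.dvd F y hy) hdvd
  exact hassoc.irreducible (minpoly.irreducible hintegral)

theorem algEquiv_map_algebraMap {K F E : Type*} [CommSemiring K] [CommSemiring F] [Semiring E]
    [Algebra K F] [Algebra K E] [Algebra F E] [IsScalarTower K F E] (σ : E ≃ₐ[F] E) (a : K) :
    σ (algebraMap K E a) = algebraMap K E a :=
  (σ : E →ₐ[F] E).map_algebraMap a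

/-- The elements of `K` by which the automorphisms of `E` over `F` translate `y`: when `y` generates
`E`, this is the Galois group of `E` over `F` as a subgroup of the additive group of `K`. -/
def translationGroup (K F : Type*) {E : Type*} [Field K] [Field F] [Field E] [Algebra K F]
    [Algebra K E] [Algebra F E] [IsScalarTower K F E] (y : E) : AddSubgroup K where
  carrier := {a | ∃ σ : Gal(E/F), σ y = y + algebraMap K E a}
  zero_mem' := ⟨1, by simp⟩
  add_mem' := by
    rintro a b ⟨σ, hσ⟩ ⟨τ, hτ⟩
    refine ⟨σ * τ, ?_⟩
    rw [AlgEquiv.mul_apply, hτ, map_add, hσ, algEquiv_map_algebraMap, map_add, add_assoc]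
  neg_mem' := by
    rintro a ⟨σ, hσ⟩
    refine ⟨σ.symm, ?_⟩
    rw [AlgEquiv.symm_apply_eq, map_add, hσ, algEquiv_map_algebraMap, map_neg,
      add_neg_cancel_right]

variable {K F E : Type*} [Field K] [Finite K] [Field F] [Field E] [Algebra K F] [Algebra K E]
  [Algebra F E] [IsScalarTower K F E] {p m n : ℕ} [Fact p.Prime] [CharP K p]

theorem irreducible_traceSubC_of_ker_subset (hm : m ≠ 0) (hn : n ≠ 0)
    (hK : Nat.card K = (p ^ m) ^ n) {g : F} {y : E}
    (hsplit : ((traceSubC (p ^ m) n g).map (algebraMap F E)).Splits)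
    (hy : traceT (p ^ m) n y = algebraMap F E g)
    (hker : ∀ v : K, traceT (p ^ m) n v = 0 → v ∈ translationGroup K F y) :
    Irreducible (traceSubC (p ^ m) n g) := by
  have : CharP F p := charP_of_injective_algebraMap (algebraMap K F).injective p
  have : IsAdditivePow E p := .of_algebra K p
  have hroot (z : E) : aeval z (traceSubC (p ^ m) n g) = traceT (p ^ m) n z - algebraMap F E g :=
    eval₂_traceSubC _ _ _ _ _
  refine irreducible_of_forall_root_isConjRoot (separable_traceSubC hm hn g) hsplit
    (y := y) (by rw [hroot, hy, sub_self]) fun z hz => ?_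
  rw [hroot, sub_eq_zero, ← hy] at hz
  obtain ⟨a, ha, rfl⟩ := exists_eq_add_algebraMap_of_traceT_eq hK hz
  obtain ⟨σ, hσ⟩ := hker a ha
  exact hσ ▸ isConjRoot_of_algEquiv y σ

theorem exists_algebraMap_eq_traceT_mul [IsGalois F E] (hK : Nat.card K = (p ^ m) ^ n) {g : F}
    {y : E} (hy : traceT (p ^ m) n y = algebraMap F E g) {c : K} {k : ℕ}
    (hc : ∀ a ∈ translationGroup K F y, traceT p k (c * a) = 0) :
    ∃ t : F, algebraMap F E t = traceT p k (algebraMap K E c * y) := by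
  have : IsAdditivePow E p := .of_algebra K p
  refine (InfiniteGalois.mem_range_algebraMap_iff_fixed _).2 fun σ => ?_
  have hσT : traceT (p ^ m) n (σ y) = traceT (p ^ m) n y := by
    rw [← RingHom.coe_coe σ, ← map_traceT, hy]
    exact σ.commutes g
  obtain ⟨a, -, ha⟩ := exists_eq_add_algebraMap_of_traceT_eq hK hσT
  have hσ : σ (algebraMap K E c * y) = algebraMap K E c * y + algebraMap K E (c * a) := by
    rw [map_mul, algEquiv_map_algebraMap, ha, mul_add, map_mul]
  rw [← RingHom.coe_coe σ, map_traceT, RingHom.coe_coe, hσ, traceT_add, ← map_traceT _ p k (c * a),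
    hc a ⟨σ, ha⟩, map_zero, add_zero]

theorem exists_pow_sub_self_eq_mul_pow_sub_self (hm : m ≠ 0) (hn : n ≠ 0)
    (hK : Nat.card K = (p ^ m) ^ n) {g : F} (hirr : ¬Irreducible (traceSubC (p ^ m) n g)) :
    ∃ c : K, c ^ p ^ m ≠ c ∧ ∃ t : F, t ^ p - t = algebraMap K F c * (g ^ p ^ m - g) := by
  have : CharP F p := charP_of_injective_algebraMap (algebraMap K F).injective p
  let E := (traceSubC (p ^ m) n g).SplittingField
  have : IsAdditivePow E p := .of_algebra F p
  have : IsGalois F E := .of_separable_splitting_field (separable_traceSubC hm hn g)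
  have hsplit := SplittingField.splits (traceSubC (p ^ m) n g)
  obtain ⟨y, hy⟩ : ∃ y : E, traceT (p ^ m) n y = algebraMap F E g := by
    have hpos := degree_traceSubC_pos (Nat.one_lt_pow hm (Fact.out : p.Prime).one_lt) hn g
    obtain ⟨y, hy⟩ := hsplit.exists_eval_eq_zero (by rw [degree_map]; exact hpos.ne')
    rw [eval_map, eval₂_traceSubC, sub_eq_zero] at hy
    exact ⟨y, hy⟩
  obtain ⟨v, hv, hvG⟩ : ∃ v : K, traceT (p ^ m) n v = 0 ∧ v ∉ translationGroup K F y := by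
    by_contra! hker
    exact hirr (irreducible_traceSubC_of_ker_subset hm hn hK hsplit hy hker)
  obtain ⟨c, hc, hcG⟩ := exists_traceT_mul_eq_zero_of_notMem hK _ hvG hv
  obtain ⟨t, ht⟩ := exists_algebraMap_eq_traceT_mul hK hy hcG
  refine ⟨c, hc, t, (algebraMap F E).injective ?_⟩
  have hcE : algebraMap K E c ^ (p ^ m) ^ n = algebraMap K E c := by
    rw [← map_pow, ← hK, pow_natCard_eq_self]
  simp only [map_sub, map_pow, map_mul, ht, ← hy, ← IsScalarTower.algebraMap_apply K F E]
  exact traceT_mul_pow_sub_self hcE y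

theorem irreducible_traceSubC {R : Type*} [CommRing R] [Algebra K R] [IsDomain R]
    [IsIntegrallyClosed R] (hm : m ≠ 0) (hn : n ≠ 0)
    (hK : Nat.card K = (p ^ m) ^ n) {g : R}
    (hg : ∀ c : K, c ≠ 0 → ∀ t : R, t ^ p - t ≠ algebraMap K R c * g) :
    Irreducible (traceSubC (p ^ m) n g) := by
  have hq := Nat.one_lt_pow hm (Fact.out : p.Prime).one_lt
  have : IsAdditivePow (FractionRing R) p := .of_algebra K p
  rw [(monic_traceSubC hq hn g).irreducible_iff_irreducible_map_fraction_map
    (K := FractionRing R), map_traceSubC]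
  by_contra hirr
  obtain ⟨c, hc, t, ht⟩ := exists_pow_sub_self_eq_mul_pow_sub_self hm hn hK hirr
  obtain ⟨d, hd, s, hs⟩ := exists_pow_sub_self_eq_mul_of_pow_sub_self hn hK hc ht
  rw [IsScalarTower.algebraMap_apply K R, ← map_mul] at hs
  obtain ⟨s', hs'⟩ := exists_pow_sub_self_eq_of_isIntegrallyClosed (Fact.out : p.Prime).one_lt hs
  exact hg d hd s' hs'

end Irreducibility

section PlaneModels

theorem not_dvd_pow_add_one {p k : ℕ} (hp : p.Prime) (hk : k ≠ 0) : ¬p ∣ p ^ k + 1 := by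
  rw [Nat.dvd_add_right (dvd_pow_self p hk)]
  exact hp.one_lt.ne' ∘ Nat.dvd_one.1

theorem eq_of_mul_pow_eq_mul_pow {p a b i j : ℕ} (hp : p.Prime) (ha : ¬p ∣ a) (hb : ¬p ∣ b)
    (h : a * p ^ i = b * p ^ j) : a = b := by
  have hval {c : ℕ} (hc : ¬p ∣ c) (k : ℕ) : (c * p ^ k).factorization p = k := by
    rw [Nat.factorization_mul (by rintro rfl; exact hc (dvd_zero p)) (pow_ne_zero k hp.ne_zero),
      Finsupp.add_apply, Nat.factorization_eq_zero_of_not_dvd hc, zero_add,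
      hp.factorization_pow, Finsupp.single_eq_same]
  obtain rfl : i = j := by rw [← hval ha i, h, hval hb j]
  exact Nat.eq_of_mul_eq_mul_right (pow_pos hp.pos i) h

theorem exists_mul_eq_mul_add_one {s n : ℕ} (hn : 1 < n) (hcop : s.Coprime n) :
    ∃ α β, s * α = β * n + 1 := by
  obtain ⟨α, -, hα⟩ := Nat.exists_mul_mod_eq_one_of_coprime hcop hn
  refine ⟨α, s * α / n, ?_⟩
  rw [mul_comm _ n, ← hα]
  exact (Nat.div_add_mod _ _).symm

section Coefficients

variable {R : Type*} [CommRing R] [IsDomain R] {p m : ℕ} [Fact p.Prime] [CharP R p]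

theorem pow_sub_self_ne_mul_uFun {s r : ℕ} (hm : m ≠ 0) (hs : s ≠ 0) (hr : r ≠ 0) (hsr : s ≠ r)
    {c : R} (hc : c ≠ 0) (t : R[X]) : t ^ p - t ≠ C c * uFun (p ^ m) (s + r) r X := by
  have hp : p.Prime := Fact.out
  have hNs : ¬p ∣ p ^ (m * s) + 1 := not_dvd_pow_add_one hp (mul_ne_zero hm hs)
  have hNr : ¬p ∣ p ^ (m * r) + 1 := not_dvd_pow_add_one hp (mul_ne_zero hm hr)
  have hu : uFun (p ^ m) (s + r) r (X : R[X]) =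
      X ^ (p ^ (m * s) + 1) - X ^ ((p ^ (m * r) + 1) * p ^ (m * s)) := by
    rw [uFun, Nat.add_sub_cancel]
    ring
  have hne (j : ℕ) : (p ^ (m * s) + 1) * p ^ j ≠ (p ^ (m * r) + 1) * p ^ (m * s) := fun hj =>
    have h := Nat.add_right_cancel (eq_of_mul_pow_eq_mul_pow hp hNs hNr hj)
    hsr (Nat.eq_of_mul_eq_mul_left (Nat.pos_of_ne_zero hm) (Nat.pow_right_injective hp.two_le h))
  rw [hu]
  refine pow_char_sub_self_ne hNs ?_ (fun j => ?_) t
  · have hne₀ := hne 0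
    rw [pow_zero, mul_one] at hne₀
    rwa [coeff_C_mul, coeff_sub, coeff_X_pow_self, coeff_X_pow, if_neg hne₀, sub_zero, mul_one]
  · have hself : (p ^ (m * s) + 1) * p ^ (j + 1) ≠ p ^ (m * s) + 1 :=
      (lt_mul_of_one_lt_right (Nat.succ_pos _) (Nat.one_lt_pow j.succ_ne_zero hp.one_lt)).ne'
    rw [coeff_C_mul, coeff_sub, coeff_X_pow, coeff_X_pow, if_neg hself, if_neg (hne (j + 1)),
      sub_zero, mul_zero]

theorem pow_sub_self_ne_mul_fFun_two_one (hm : m ≠ 0) (hp₂ : Odd p) {c : R} (hc : c ≠ 0)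
    (t : R[X]) : t ^ p - t ≠ C c * fFun (p ^ m) 2 1 X := by
  have hp : p.Prime := Fact.out
  have hf : fFun (p ^ m) 2 1 (X : R[X]) = C 2 * X ^ (p ^ m + 1) := by
    rw [fFun, traceT_one, traceT_one, pow_one, add_comm 1, C_ofNat, two_mul]
  have h₂ : (2 : R) ≠ 0 :=
    Ring.two_ne_zero (by rw [ringChar.eq R p]; rintro rfl; exact absurd hp₂ (by decide))
  rw [hf, ← mul_assoc, ← C_mul]
  refine pow_char_sub_self_ne (not_dvd_pow_add_one hp hm) ?_ (fun j => ?_) t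
  · rw [coeff_C_mul, coeff_X_pow_self, mul_one]
    exact mul_ne_zero hc h₂
  · have hself : (p ^ m + 1) * p ^ (j + 1) ≠ p ^ m + 1 :=
      (lt_mul_of_one_lt_right (Nat.succ_pos _) (Nat.one_lt_pow j.succ_ne_zero hp.one_lt)).ne'
    rw [coeff_C_mul, coeff_X_pow, if_neg hself, mul_zero]

end Coefficients

section Irreducibility

variable {p m n r : ℕ} [Fact p.Prime]

theorem irreducible_traceSubC_fFun_iff_uFun {R : Type*} [CommRing R] [IsDomain R]
    [UniqueFactorizationMonoid R] [CharP R p] {α β : ℕ} (hm : m ≠ 0) (hn : n ≠ 0) (hrn : r ≤ n)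
    (hαβ : (n - r) * α = β * n + 1) (x : R) :
    Irreducible (traceSubC (p ^ m) n (fFun (p ^ m) n r x)) ↔
      Irreducible (traceSubC (p ^ m) n (uFun (p ^ m) n r x)) := by
  have hq : 1 < p ^ m := Nat.one_lt_pow hm (Fact.out : p.Prime).one_lt
  rw [irreducible_iff_isDomain_adjoinRoot (monic_traceSubC hq hn _).ne_zero,
    irreducible_iff_isDomain_adjoinRoot (monic_traceSubC hq hn _).ne_zero]
  let e := coordinateRingEquiv (p := p) (m := m) hrn hαβ x
  exact ⟨fun _ => e.toMulEquiv.isDomain _, fun _ => e.symm.toMulEquiv.isDomain _⟩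

theorem irreducible_traceSubC_X {K L : Type*} [Field K] [Finite K] [Field L] [Algebra K L]
    [CharP K p] (hm : m ≠ 0) (hn : n ≠ 0) (hK : Nat.card K = (p ^ m) ^ n) {g : L[X]}
    (hg : ∀ c : L, c ≠ 0 → ∀ t : L[X], t ^ p - t ≠ C c * g) :
    Irreducible (traceSubC (p ^ m) n g) :=
  irreducible_traceSubC hm hn hK fun c hc =>
    hg (algebraMap K L c) ((_root_.map_ne_zero _).2 hc)

variable {L : Type*} [Field L] [CharP L p]

theorem irreducible_traceSubC_fFun_and_uFun {K : Type*} [Field K] [Finite K] [Algebra K L]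
    [CharP K p] (hm : m ≠ 0) (hr : r ≠ 0) (hrn : r < n) (hcop : n.Coprime r)
    (hdeg : n = 2 → Odd p) (hK : Nat.card K = (p ^ m) ^ n) :
    Irreducible (traceSubC (p ^ m) n (fFun (p ^ m) n r (X : L[X]))) ∧
      Irreducible (traceSubC (p ^ m) n (uFun (p ^ m) n r (X : L[X]))) := by
  obtain ⟨α, β, hαβ⟩ := exists_mul_eq_mul_add_one (by omega)
    ((Nat.coprime_self_sub_right hrn.le).2 hcop).symm
  have hiff := irreducible_traceSubC_fFun_iff_uFun hm (by omega) hrn.le hαβ (X : L[X])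
  by_cases hne : n = 2 * r
  · obtain rfl : r = 1 := Nat.dvd_one.1 (hcop ▸ Nat.dvd_gcd (hne ▸ Nat.dvd_mul_left r 2) dvd_rfl)
    obtain rfl : n = 2 := hne
    have hf := irreducible_traceSubC_X (L := L) hm two_ne_zero hK fun c hc t =>
      pow_sub_self_ne_mul_fFun_two_one hm (hdeg rfl) hc t
    exact ⟨hf, hiff.1 hf⟩
  · obtain ⟨s, rfl⟩ := Nat.exists_eq_add_of_le' hrn.le
    have hs : s ≠ 0 := by omega
    have hsr : s ≠ r := by omega
    have hu : Irreducible (traceSubC (p ^ m) (s + r) (uFun (p ^ m) (s + r) r (X : L[X]))) :=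
      irreducible_traceSubC_X hm (by omega) hK fun c hc t =>
        pow_sub_self_ne_mul_uFun hm hs hr hsr hc t
    exact ⟨hiff.2 hu, hu⟩

theorem irreducible_traceSubC_fFun_and_uFun_of_isAlgClosed [IsAlgClosed L] (hm : m ≠ 0)
    (hr : r ≠ 0) (hrn : r < n) (hcop : n.Coprime r) (hdeg : n = 2 → Odd p) :
    Irreducible (traceSubC (p ^ m) n (fFun (p ^ m) n r (X : L[X]))) ∧
      Irreducible (traceSubC (p ^ m) n (uFun (p ^ m) n r (X : L[X]))) := by
  have hmn : m * n ≠ 0 := mul_ne_zero hm (Nat.ne_zero_of_lt hrn)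
  let : Algebra (ZMod p) L := ZMod.algebra L p
  let : Algebra (GaloisField p (m * n)) L :=
    (IsAlgClosed.lift : GaloisField p (m * n) →ₐ[ZMod p] L).toRingHom.toAlgebra
  refine irreducible_traceSubC_fFun_and_uFun (K := GaloisField p (m * n)) hm hr hrn hcop hdeg ?_
  rw [GaloisField.card p _ hmn, pow_mul]

end Irreducibility

section FunctionField

variable {K : Type*} [Field K]

/-- The isomorphism of function fields induced by an isomorphism of coordinate rings that fixes
`x`. -/
noncomputable def funFieldEquiv {P Q : K[X][X]} (e : AdjoinRoot Q ≃ₐ[K[X]] AdjoinRoot P) :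
    FunField Q ≃ₐ[K] FunField P :=
  IsFractionRing.algEquivOfAlgEquiv (e.restrictScalars K)

theorem funFieldEquiv_xFun {P Q : K[X][X]} (e : AdjoinRoot Q ≃ₐ[K[X]] AdjoinRoot P) :
    funFieldEquiv e (xFun Q) = xFun P :=
  (IsFractionRing.algEquivOfAlgEquiv_algebraMap _ _).trans
    (congrArg (algebraMap _ (FunField P)) (e.commutes X))

theorem funFieldEquiv_yFun {P Q : K[X][X]} (e : AdjoinRoot Q ≃ₐ[K[X]] AdjoinRoot P) :
    funFieldEquiv e (yFun Q) = algebraMap _ (FunField P) (e (AdjoinRoot.root Q)) :=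
  IsFractionRing.algEquivOfAlgEquiv_algebraMap _ _

theorem wFun_eq_wCoord (q n r α β : ℕ) :
    wFun K q n r α β = wCoord q n r α β (xFun (curveX K q n r)) (yFun (curveX K q n r)) := by
  rw [wFun, wCoord, traceT, traceT]
  congr 1
  · simp only [zCoord, zZero, ← pow_mul]
  · refine Finset.sum_bij' (fun i _ => β - i) (fun j _ => β - j) ?_ ?_ ?_ ?_ ?_ <;>
      intro i hi <;> simp only [Finset.mem_Icc, Finset.mem_range] at hi ⊢
    · omega
    · omega
    · omega
    · omega
    · rw [← pow_mul, pow_succ' q, pow_mul q]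

theorem traceT_yFun_newModel (q n r : ℕ) :
    traceT q n (yFun (newModel K q n r)) = uFun q n r (xFun (newModel K q n r)) := by
  rw [yFun, xFun, ← map_traceT, ← map_uFun, ← map_uFun]
  exact congrArg (algebraMap _ (FunField (newModel K q n r))) (traceT_root q n _)

variable {p m n r : ℕ} [Fact p.Prime] [CharP K p]

theorem curveX_eq_traceSubC {q : ℕ} (hq : 1 < q) (hr : r ≠ 0) (hrn : r < n) :
    curveX K q n r = traceSubC q n (fFun q n r X) := by
  rw [curveX, fPoly_eq_fFun hq hr hrn, traceSubC]

theorem exists_newModel_algEquiv_curveX (hm : m ≠ 0) (hr : r ≠ 0) (hrn : r < n) {α β : ℕ}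
    (hαβ : (n - r) * α = β * n + 1) :
    ∃ e : AdjoinRoot (newModel K (p ^ m) n r) ≃ₐ[K[X]] AdjoinRoot (curveX K (p ^ m) n r),
      e (AdjoinRoot.root _) =
        wCoord (p ^ m) n r α β (AdjoinRoot.of _ X) (AdjoinRoot.root _) := by
  rw [curveX_eq_traceSubC (Nat.one_lt_pow hm (Fact.out : p.Prime).one_lt) hr hrn]
  exact ⟨coordinateRingEquiv hrn.le hαβ X, coordinateRingEquiv_root hrn.le hαβ X⟩

theorem exists_funField_algEquiv (hm : m ≠ 0) (hr : r ≠ 0) (hrn : r < n) {α β : ℕ}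
    (hαβ : (n - r) * α = β * n + 1) :
    ∃ φ : FunField (newModel K (p ^ m) n r) ≃ₐ[K] FunField (curveX K (p ^ m) n r),
      φ (xFun (newModel K (p ^ m) n r)) = xFun (curveX K (p ^ m) n r) ∧
        φ (yFun (newModel K (p ^ m) n r)) = wFun K (p ^ m) n r α β := by
  obtain ⟨e, he⟩ := exists_newModel_algEquiv_curveX (K := K) hm hr hrn hαβ
  refine ⟨funFieldEquiv e, funFieldEquiv_xFun e, ?_⟩
  rw [funFieldEquiv_yFun, he, map_wCoord, wFun_eq_wCoord, xFun, yFun]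

theorem geomIrreducible_curveX_and_newModel (hm : m ≠ 0) (hr : r ≠ 0) (hrn : r < n)
    (hcop : n.Coprime r) (hdeg : n = 2 → Odd p) :
    GeomIrreducible (curveX K (p ^ m) n r) ∧ GeomIrreducible (newModel K (p ^ m) n r) := by
  have : CharP (AlgebraicClosure K) p :=
    charP_of_injective_algebraMap (algebraMap K (AlgebraicClosure K)).injective p
  have hq : 1 < p ^ m := Nat.one_lt_pow hm (Fact.out : p.Prime).one_lt
  rw [GeomIrreducible, GeomIrreducible, curveX_eq_traceSubC hq hr hrn, newModel, ← traceSubC,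
    map_traceSubC, map_traceSubC, map_fFun, map_uFun, coe_mapRingHom, map_X]
  exact irreducible_traceSubC_fFun_and_uFun_of_isAlgClosed hm hr hrn hcop hdeg

end FunctionField

end PlaneModels

theorem mainTheorem4_general {p m n r : ℕ} [Fact p.Prime] (hm : m ≠ 0) (hr : r ≠ 0) (hrn : r < n)
    (hcop : n.Coprime r) (hdeg : n = 2 → Odd p) (K : Type*) [Field K] [CharP K p] :
    IsPlaneModel (curveX K (p ^ m) n r) (newModel K (p ^ m) n r) ∧
      ∀ α β : ℕ, (n - r) * α = β * n + 1 →
        traceT (p ^ m) n (wFun K (p ^ m) n r α β) =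
            uFun (p ^ m) n r (xFun (curveX K (p ^ m) n r)) ∧
          ∃ φ : FunField (newModel K (p ^ m) n r) ≃ₐ[K] FunField (curveX K (p ^ m) n r),
            φ (xFun (newModel K (p ^ m) n r)) = xFun (curveX K (p ^ m) n r) ∧
              φ (yFun (newModel K (p ^ m) n r)) = wFun K (p ^ m) n r α β := by
  obtain ⟨hX, hN⟩ := geomIrreducible_curveX_and_newModel (K := K) hm hr hrn hcop hdeg
  obtain ⟨α, β, hαβ⟩ := exists_mul_eq_mul_add_one (by omega)
    ((Nat.coprime_self_sub_right hrn.le).2 hcop).symm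
  obtain ⟨φ, -⟩ := exists_funField_algEquiv (K := K) hm hr hrn hαβ
  refine ⟨⟨hX, hN, ⟨φ⟩⟩, fun α β hαβ => ?_⟩
  obtain ⟨φ, hx, hy⟩ := exists_funField_algEquiv (K := K) hm hr hrn hαβ
  refine ⟨?_, φ, hx, hy⟩
  rw [← hx, ← hy, ← RingHom.coe_coe φ, ← map_traceT, ← map_uFun, traceT_yFun_newModel]

theorem mainTheorem4 (q n r : ℕ) (hq : IsPrimePow q) (hn : 2 ≤ n)
    (hnr : n ≤ 2 * r) (hrn : r < n) (hcop : Nat.Coprime n r)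
    (hdeg : n = 2 → Odd q)
    (K : Type*) [Field K] [Finite K] (hK : Nat.card K = q ^ n) :
    IsPlaneModel (curveX K q n r) (newModel K q n r) ∧
    ∀ α β : ℕ, 0 < α → 0 < β → (n - r) * α = β * n + 1 →
      ∃ a : K,
        traceT q n (wFun K q n r α β - algebraMap K (FunField (curveX K q n r)) a) =
          uFun q n r (xFun (curveX K q n r)) ∧
        ∃ φ : FunField (newModel K q n r) ≃ₐ[K] FunField (curveX K q n r),
          φ (xFun (newModel K q n r)) = xFun (curveX K q n r) ∧
          φ (yFun (newModel K q n r)) =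
            wFun K q n r α β - algebraMap K (FunField (curveX K q n r)) a := by
  obtain ⟨p, m, hp, hm, rfl⟩ := hq
  have : Fact p.Prime := ⟨hp.nat_prime⟩
  have : CharP K p := by
    have := Fintype.ofFinite K
    exact charP_of_card_eq_prime_pow (f := m * n) (by
      rw [← Nat.card_eq_fintype_card, hK, pow_mul])
  obtain ⟨hmodel, hw⟩ := mainTheorem4_general hm.ne' (by omega) hrn hcop
    (fun h => (Nat.odd_pow_iff hm.ne').1 (hdeg h)) K
  exact ⟨hmodel, fun α β _ _ h => ⟨0, by simpa only [map_zero, sub_zero] using hw α β h⟩⟩
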